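/- Let $\mathcal H$ be a separable complex Hilbert space and let $\mathcal R\subseteq\mathcal L(\mathcal H)$ be a von Neumann algebra (containing the identity operator $I$), with real vector space of self-adjoint elements $\mathcal R_{sa}$. A valuation function is a map $v:\mathcal R_{sa}\to\mathbb R$ such that (a) $v(A)\in\operatorname{sp}A$ for all $A\in\mathcal R_{sa}$, and (b) $v(f(A))=f(v(A))$ for all $A\in\mathcal R_{sa}$ and all Borel functions $f:\mathbb R\to\mathbb R$ that are bounded on $\operatorname{sp}A$, where $f(A)\in\mathcal R_{sa}$ is given by the Borel functional calculus. Its extension $v':\mathcal R\to\mathbb C$ is $v'(A_1+iA_2)=v(A_1)+iv(A_2)$ for $A_1,A_2\in\mathcal R_{sa}$. Let $v$ be a valuation function on $\mathcal R_{sa}$ and let $\mathcal M\subseteq\mathcal R$ be an abelian von Neumann subalgebra (with the same identity $I$). Then $v'|_{\mathcal M}$ is a character of $\mathcal M$, that is, a nonzero (automatically continuous) multiplicative $\mathbb C$-linear functional $\mathcal M\to\mathbb C$; and $v|_{\mathcal M_{sa}}:\mathcal M_{sa}\to\mathbb R$ is $\mathbb R$-linear. -/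

import Mathlib

noncomputable section

namespace BorelFC

open MeasureTheory Filter Topology
open scoped InnerProductSpace CompactlySupported NNReal

variable {H : Type*} [NormedAddCommGroup H] [InnerProductSpace ℂ H] [CompleteSpace H]

/-! ### Borel functional calculus of a bounded self-adjoint operator -/

/-- The positive linear functional `g ↦ ⟪x, g(A) x⟫` on the continuous functions on `sp A`. -/
def spectralFunctional {A : H →L[ℂ] H} (hA : IsSelfAdjoint A) (x : H) :
    C_c(spectrum ℝ A, ℝ) →ₚ[ℝ] ℝ :=
  PositiveLinearMap.mk₀
    { toFun := fun g => (⟪x, cfcHom (R := ℝ) hA g.toContinuousMap x⟫_ℂ).re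
      map_add' := fun g h => by
        have : (g + h).toContinuousMap = g.toContinuousMap + h.toContinuousMap := rfl
        rw [this, map_add]
        simp
      map_smul' := fun c g => by
        have : (c • g).toContinuousMap = c • g.toContinuousMap := rfl
        rw [this, map_smul, smul_apply, inner_smul_right_eq_smul]
        simp }
    (fun g hg => by
      have h1 : 0 ≤ cfcHom (R := ℝ) hA g.toContinuousMap :=
        (cfcHom_nonneg_iff (R := ℝ) hA).2 (fun t => hg t)
      have h2 := (ContinuousLinearMap.nonneg_iff_isPositive _).1 h1
      exact h2.re_inner_nonneg_right x)

/-- The spectral measure of `A` at the vector `x`, that is `S ↦ ⟪x, E_A(S) x⟫` on `sp A`: the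
measure that represents `g ↦ ⟪x, g(A) x⟫` by the Riesz–Markov–Kakutani theorem. -/
def spectralMeasure {A : H →L[ℂ] H} (hA : IsSelfAdjoint A) (x : H) :
    Measure (spectrum ℝ A) :=
  RealRMK.rieszMeasure (spectralFunctional hA x)

instance {A : H →L[ℂ] H} (hA : IsSelfAdjoint A) (x : H) :
    IsFiniteMeasure (spectralMeasure hA x) := by
  unfold spectralMeasure; infer_instance

/-- `B = ∫ f dE_A`, that is `⟪x, B x⟫ = ∫ f d⟪x, E_A x⟫` for all vectors `x`. -/
def IsSpectralIntegral {A : H →L[ℂ] H} (hA : IsSelfAdjoint A) (f : spectrum ℝ A → ℝ)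
    (B : H →L[ℂ] H) : Prop :=
  ∀ x : H, ⟪x, B x⟫_ℂ = ((∫ t, f t ∂spectralMeasure hA x : ℝ) : ℂ)

theorem IsSpectralIntegral.isSelfAdjoint {A : H →L[ℂ] H} {hA : IsSelfAdjoint A}
    {f : spectrum ℝ A → ℝ} {B : H →L[ℂ] H} (h : IsSpectralIntegral hA f B) :
    IsSelfAdjoint B := by
  rw [ContinuousLinearMap.isSelfAdjoint_iff_isSymmetric, LinearMap.isSymmetric_iff_inner_map_self_real]
  intro x
  have h1 : ⟪B x, x⟫_ℂ = ((∫ t, f t ∂spectralMeasure hA x : ℝ) : ℂ) := by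
    rw [← inner_conj_symm, h x, Complex.conj_ofReal]
  change (starRingEnd ℂ) ⟪B x, x⟫_ℂ = ⟪B x, x⟫_ℂ
  rw [h1, Complex.conj_ofReal]

theorem IsSpectralIntegral.unique {A : H →L[ℂ] H} {hA : IsSelfAdjoint A}
    {f : spectrum ℝ A → ℝ} {B C : H →L[ℂ] H} (hB : IsSpectralIntegral hA f B)
    (hC : IsSpectralIntegral hA f C) : B = C := by
  apply ContinuousLinearMap.coe_injective
  rw [← ext_inner_map]
  intro x
  change ⟪B x, x⟫_ℂ = ⟪C x, x⟫_ℂ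
  rw [← inner_conj_symm, ← inner_conj_symm (C x), hB x, hC x]

/-- `f` has a spectral integral that commutes with everything that commutes with `A`. -/
def HasIntegral {A : H →L[ℂ] H} (hA : IsSelfAdjoint A) (f : spectrum ℝ A → ℝ) : Prop :=
  ∃ B : H →L[ℂ] H, IsSpectralIntegral hA f B ∧ ∀ C : H →L[ℂ] H, Commute A C → Commute B C

theorem hasIntegral_continuous {A : H →L[ℂ] H} (hA : IsSelfAdjoint A)
    (g : C(spectrum ℝ A, ℝ)) : HasIntegral hA g := by
  refine ⟨cfcHom (R := ℝ) hA g, fun x => ?_, fun C hC => hA.commute_cfcHom hA hC g⟩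
  have hc : CompactSpace (spectrum ℝ A) := inferInstance
  have h1 := RealRMK.integral_rieszMeasure (spectralFunctional hA x)
    (CompactlySupportedContinuousMap.continuousMapEquiv g)
  have h2 : IsSelfAdjoint (cfcHom (R := ℝ) hA g) := cfcHom_predicate hA g
  have h3 : (⟪x, cfcHom (R := ℝ) hA g x⟫_ℂ).im = 0 := by
    have h4 := (ContinuousLinearMap.isSelfAdjoint_iff_isSymmetric.1 h2).im_inner_self_apply x
    exact h4
  apply Complex.ext
  · rw [Complex.ofReal_re]
    exact h1.symm
  · rw [Complex.ofReal_im, h3]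

theorem HasIntegral.lincomb {A : H →L[ℂ] H} {hA : IsSelfAdjoint A} {f g : spectrum ℝ A → ℝ}
    (hf : HasIntegral hA f) (hg : HasIntegral hA g)
    (hfi : ∀ x, Integrable f (spectralMeasure hA x))
    (hgi : ∀ x, Integrable g (spectralMeasure hA x)) (a b : ℝ) :
    HasIntegral hA (fun t => a * f t + b * g t) := by
  obtain ⟨B, hB, hB'⟩ := hf
  obtain ⟨C, hC, hC'⟩ := hg
  refine ⟨(a : ℂ) • B + (b : ℂ) • C, fun x => ?_, fun D hD => ?_⟩
  · rw [integral_add ((hfi x).const_mul a) ((hgi x).const_mul b), integral_const_mul,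
      integral_const_mul]
    simp [hB x, hC x]
  · exact ((hB' D hD).smul_left _).add_left ((hC' D hD).smul_left _)

theorem HasIntegral.limit {A : H →L[ℂ] H} {hA : IsSelfAdjoint A} {F : ℕ → spectrum ℝ A → ℝ}
    {f : spectrum ℝ A → ℝ} (hF : ∀ n, HasIntegral hA (F n)) (hm : ∀ n, Measurable (F n))
    {K : ℝ} (hK : ∀ n t, |F n t| ≤ K)
    (hlim : ∀ t, Tendsto (fun n => F n t) atTop (𝓝 (f t))) : HasIntegral hA f := by
  choose B hB hB' using hF
  have hint : ∀ x, Tendsto (fun n => ∫ t, F n t ∂spectralMeasure hA x) atTop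
      (𝓝 (∫ t, f t ∂spectralMeasure hA x)) := fun x =>
    tendsto_integral_of_dominated_convergence (fun _ => K)
      (fun n => (hm n).aestronglyMeasurable) (integrable_const K)
      (fun n => ae_of_all _ (hK n)) (ae_of_all _ hlim)
  have hq : ∀ x, Tendsto (fun n => ⟪B n x, x⟫_ℂ) atTop
      (𝓝 ((∫ t, f t ∂spectralMeasure hA x : ℝ) : ℂ)) := by
    intro x
    have h1 : ∀ n, ⟪B n x, x⟫_ℂ = ((∫ t, F n t ∂spectralMeasure hA x : ℝ) : ℂ) := by
      intro n
      rw [← inner_conj_symm, hB n x, Complex.conj_ofReal]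
    simp only [h1]
    exact (Complex.continuous_ofReal.tendsto _).comp (hint x)
  have hs : ∀ n, (B n : H →ₗ[ℂ] H).IsSymmetric := fun n =>
    ContinuousLinearMap.isSelfAdjoint_iff_isSymmetric.1 (hB n).isSelfAdjoint
  have hex : ∀ x y, ∃ l : ℂ, Tendsto (fun n => ⟪B n x, y⟫_ℂ) atTop (𝓝 l) := by
    intro x y
    have h0 := ((((hq (x + y)).sub (hq (x - y))).sub
      ((hq (x + Complex.I • y)).const_mul Complex.I)).add
        ((hq (x - Complex.I • y)).const_mul Complex.I)).div_const 4
    refine ⟨_, h0.congr fun n => ?_⟩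
    exact (inner_map_polarization' (B n : H →ₗ[ℂ] H) x y).symm
  choose l hl using hex
  let Φ : H → (H →L[ℂ] ℂ) := fun x =>
    continuousLinearMapOfTendsto (fun n => innerSL ℂ (B n x)) (f := l x)
      (tendsto_pi_nhds.2 (fun y => by simpa using hl x y))
  have hΦ : ∀ x y, Φ x y = l x y := fun x y => rfl
  let T : H → H := fun x => (InnerProductSpace.toDual ℂ H).symm (Φ x)
  have hT : ∀ x y, Tendsto (fun n => ⟪B n x, y⟫_ℂ) atTop (𝓝 ⟪T x, y⟫_ℂ) := by
    intro x y
    have : ⟪T x, y⟫_ℂ = l x y := by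
      rw [← hΦ]; exact InnerProductSpace.toDual_symm_apply
    rw [this]; exact hl x y
  let L : H →ₗ[ℂ] H :=
    { toFun := T
      map_add' := fun x y => by
        refine ext_inner_right ℂ fun z => tendsto_nhds_unique (hT _ z) ?_
        simp only [map_add, inner_add_left]
        exact (hT x z).add (hT y z)
      map_smul' := fun c x => by
        refine ext_inner_right ℂ fun z => tendsto_nhds_unique (hT _ z) ?_
        simp only [map_smul, inner_smul_left, RingHom.id_apply]
        exact (hT x z).const_mul _ }
  have hL : L.IsSymmetric := by
    intro x y
    refine tendsto_nhds_unique (hT x y) ?_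
    have h1 : ∀ n, ⟪B n x, y⟫_ℂ = (starRingEnd ℂ) ⟪B n y, x⟫_ℂ := fun n => by
      rw [inner_conj_symm]; exact hs n x y
    simp only [h1]
    rw [← inner_conj_symm]
    exact (Complex.continuous_conj.tendsto _).comp (hT y x)
  refine ⟨⟨L, hL.continuous⟩, fun x => ?_, fun C hC => ?_⟩
  · change ⟪x, T x⟫_ℂ = _
    rw [← inner_conj_symm, tendsto_nhds_unique (hT x x) (hq x), Complex.conj_ofReal]
  · refine ContinuousLinearMap.ext fun x => ext_inner_right ℂ fun y => ?_
    change ⟪T (C x), y⟫_ℂ = ⟪C (T x), y⟫_ℂ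
    refine tendsto_nhds_unique (hT _ y) ?_
    have h1 : ∀ n, ⟪B n (C x), y⟫_ℂ = ⟪B n x, C.adjoint y⟫_ℂ := fun n => by
      rw [ContinuousLinearMap.adjoint_inner_right]
      exact congrArg (fun z => ⟪z, y⟫_ℂ) (DFunLike.congr_fun (hB' n C hC).eq x)
    simp only [h1]
    rw [← ContinuousLinearMap.adjoint_inner_right]
    exact hT _ _

theorem hasIntegral_indicator {A : H →L[ℂ] H} (hA : IsSelfAdjoint A) (s : Set (spectrum ℝ A))
    (hs : MeasurableSet s) : HasIntegral hA (s.indicator fun _ => (1 : ℝ)) := by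
  have hind : ∀ (s : Set (spectrum ℝ A)), MeasurableSet s → ∀ x,
      Integrable (s.indicator fun _ => (1 : ℝ)) (spectralMeasure hA x) :=
    fun s hs x => (integrable_const 1).indicator hs
  have hzero : HasIntegral hA (fun _ => (0 : ℝ)) := hasIntegral_continuous hA 0
  have hone : HasIntegral hA (fun _ => (1 : ℝ)) := hasIntegral_continuous hA 1
  induction s, hs using MeasurableSpace.induction_on_inter
    (BorelSpace.measurable_eq.trans borel_eq_generateFrom_isClosed)
    (isPiSystem_isClosed (α := spectrum ℝ A)) with
  | empty => simpa using hzero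
  | basic t ht' =>
    replace ht' : IsClosed t := ht'
    refine HasIntegral.limit (F := fun n x => (ht'.apprSeq n x : ℝ)) (K := 1)
      (fun n => hasIntegral_continuous hA ⟨fun x => (ht'.apprSeq n x : ℝ), by fun_prop⟩)
      (fun n => by fun_prop) (fun n x => ?_) (fun x => ?_)
    · rw [abs_of_nonneg (NNReal.coe_nonneg _)]
      exact_mod_cast HasOuterApproxClosed.apprSeq_apply_le_one ht' n x
    · have h1 := tendsto_pi_nhds.1 (HasOuterApproxClosed.tendsto_apprSeq ht') x
      have h2 := (NNReal.continuous_coe.tendsto _).comp h1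
      have h3 : ((t.indicator (fun _ => (1 : ℝ≥0)) x : ℝ≥0) : ℝ)
          = t.indicator (fun _ => (1 : ℝ)) x := by
        by_cases hx : x ∈ t <;> simp [hx]
      rw [h3] at h2
      exact h2
  | compl t ht ih =>
    have h := hone.lincomb ih (fun x => integrable_const 1) (hind t ht) 1 (-1)
    convert h using 1
    funext x
    by_cases hx : x ∈ t <;> simp [hx]
  | iUnion f hd hfm ih =>
    have hpart : ∀ n, HasIntegral hA ((⋃ i ∈ Finset.range n, f i).indicator fun _ => (1 : ℝ)) := by
      intro n
      induction n with
      | zero => simpa using hzero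
      | succ n ihn =>
        have h := ihn.lincomb (ih n)
          (hind _ (Finset.measurableSet_biUnion _ fun i _ => hfm i)) (hind _ (hfm n)) 1 1
        convert h using 1
        funext x
        by_cases hx : x ∈ f n
        · have : x ∉ ⋃ i ∈ Finset.range n, f i := by
            simp only [Set.mem_iUnion, not_exists, Finset.mem_range]
            intro i hi hxi
            exact Set.disjoint_left.1 (hd hi.ne) hxi hx
          have h2 : x ∈ ⋃ i ∈ Finset.range (n + 1), f i := by
            simp only [Set.mem_iUnion, Finset.mem_range]
            exact ⟨n, by omega, hx⟩
          simp only [Set.indicator_of_mem h2, Set.indicator_of_notMem this,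
            Set.indicator_of_mem hx]
          norm_num
        · have h2 : x ∈ (⋃ i ∈ Finset.range (n + 1), f i) ↔ x ∈ ⋃ i ∈ Finset.range n, f i := by
            simp only [Set.mem_iUnion, Finset.mem_range, exists_prop]
            constructor
            · rintro ⟨i, hi, hxi⟩
              refine ⟨i, ?_, hxi⟩
              rcases Nat.lt_succ_iff_lt_or_eq.1 hi with h | h
              · exact h
              · exact absurd (h ▸ hxi) hx
            · rintro ⟨i, hi, hxi⟩
              exact ⟨i, by omega, hxi⟩
          by_cases h3 : x ∈ ⋃ i ∈ Finset.range n, f i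
          · rw [Set.indicator_of_mem (h2.2 h3), Set.indicator_of_mem h3, Set.indicator_of_notMem hx]
            norm_num
          · rw [Set.indicator_of_notMem (fun h => h3 (h2.1 h)), Set.indicator_of_notMem h3,
              Set.indicator_of_notMem hx]
            norm_num
    refine HasIntegral.limit hpart (K := 1)
      (fun n => measurable_const.indicator (Finset.measurableSet_biUnion _ fun i _ => hfm i))
      (fun n x => ?_) (fun x => ?_)
    · by_cases hx : x ∈ ⋃ i ∈ Finset.range n, f i
      · rw [Set.indicator_of_mem hx]; norm_num
      · rw [Set.indicator_of_notMem hx]; norm_num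
    · by_cases hx : ∃ i, x ∈ f i
      · obtain ⟨i, hi⟩ := hx
        refine tendsto_const_nhds.congr' ?_
        filter_upwards [eventually_gt_atTop i] with n hn
        have : x ∈ ⋃ i ∈ Finset.range n, f i := by
          simp only [Set.mem_iUnion, Finset.mem_range]
          exact ⟨i, hn, hi⟩
        rw [Set.indicator_of_mem (Set.mem_iUnion.2 ⟨i, hi⟩),
          Set.indicator_of_mem this]
      · have h1 : x ∉ ⋃ i, f i := by simpa using hx
        have h2 : ∀ n, x ∉ ⋃ i ∈ Finset.range n, f i := by
          intro n h
          simp only [Set.mem_iUnion] at h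
          obtain ⟨i, _, hi⟩ := h
          exact hx ⟨i, hi⟩
        simp only [Set.indicator_of_notMem h1, Set.indicator_of_notMem (h2 _)]
        exact tendsto_const_nhds

theorem hasIntegral_of_bounded {A : H →L[ℂ] H} (hA : IsSelfAdjoint A) {f : spectrum ℝ A → ℝ}
    (hf : Measurable f) {K : ℝ} (hK : ∀ t, |f t| ≤ K) : HasIntegral hA f := by
  have hsimple : ∀ g : SimpleFunc (spectrum ℝ A) ℝ, HasIntegral hA g := by
    intro g
    induction g using SimpleFunc.induction with
    | const c hs =>
      have h := (hasIntegral_indicator hA _ hs).lincomb (hasIntegral_indicator hA _ hs)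
        (fun x => (integrable_const 1).indicator hs) (fun x => (integrable_const 1).indicator hs) c 0
      convert h using 1
      funext t
      rename_i s
      by_cases ht : t ∈ s <;> simp [ht]
    | add _ h1 h2 =>
      rename_i f g _
      have h := h1.lincomb h2 (fun x => SimpleFunc.integrable_of_isFiniteMeasure _)
        (fun x => SimpleFunc.integrable_of_isFiniteMeasure _) 1 1
      convert h using 1
      funext t
      simp
  have hsm := hf.stronglyMeasurable
  have hK' : ∀ t, |f t| ≤ max K 0 := fun t => (hK t).trans (le_max_left _ _)
  exact HasIntegral.limit (F := fun n => hsm.approxBounded (max K 0) n) (fun n => hsimple _)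
    (fun n => SimpleFunc.measurable _)
    (fun n t => hsm.norm_approxBounded_le (le_max_right K 0) n t)
    (fun t => hsm.tendsto_approxBounded_of_norm_le (hK' t))

end BorelFC

namespace VonNeumannAlgebra

open scoped InnerProductSpace

variable {H : Type*} [NormedAddCommGroup H] [InnerProductSpace ℂ H] [CompleteSpace H]

/-- The real vector space `R_sa` of self-adjoint elements of `R`. -/
abbrev SelfAdjointPart (R : VonNeumannAlgebra H) : Type _ := selfAdjoint R.toStarSubalgebra

/-- A self-adjoint element of `R` as an operator on `H`. -/
def SelfAdjointPart.op {R : VonNeumannAlgebra H} (A : R.SelfAdjointPart) : H →L[ℂ] H :=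
  ((A : R.toStarSubalgebra) : H →L[ℂ] H)

theorem SelfAdjointPart.isSelfAdjoint_op {R : VonNeumannAlgebra H} (A : R.SelfAdjointPart) :
    IsSelfAdjoint A.op :=
  congrArg Subtype.val A.2

theorem existsUnique_borelFun {R : VonNeumannAlgebra H} (A : R.SelfAdjointPart) {f : ℝ → ℝ}
    (hf : Measurable f) (hb : ∃ K, ∀ t ∈ spectrum ℝ A.op, |f t| ≤ K) :
    ∃! B : R.SelfAdjointPart,
      BorelFC.IsSpectralIntegral A.isSelfAdjoint_op (fun t => f t) B.op := by
  obtain ⟨K, hK⟩ := hb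
  obtain ⟨B, hB, hB'⟩ := BorelFC.hasIntegral_of_bounded A.isSelfAdjoint_op
    (f := fun t => f t) (hf.comp measurable_subtype_coe) (fun t => hK t t.2)
  have hAR : A.op ∈ R := (A : R.toStarSubalgebra).2
  have hBR : B ∈ R := by
    rw [← R.commutant_commutant, mem_commutant_iff]
    intro C hC
    exact (hB' C ((mem_commutant_iff.1 hC) _ hAR)).eq.symm
  refine ⟨⟨⟨B, hBR⟩, Subtype.ext hB.isSelfAdjoint⟩, hB, fun C hC => ?_⟩
  exact Subtype.ext (Subtype.ext (hC.unique hB))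

/-- `f(A) = ∫ f dE_A ∈ R_sa`, for `A ∈ R_sa` and a Borel function `f : ℝ → ℝ` that is bounded
on `sp A`. -/
def borelFun {R : VonNeumannAlgebra H} (A : R.SelfAdjointPart) (f : ℝ → ℝ)
    (hf : Measurable f) (hb : ∃ K, ∀ t ∈ spectrum ℝ A.op, |f t| ≤ K) : R.SelfAdjointPart :=
  (existsUnique_borelFun A hf hb).choose

theorem inner_borelFun {R : VonNeumannAlgebra H} (A : R.SelfAdjointPart) (f : ℝ → ℝ)
    (hf : Measurable f) (hb : ∃ K, ∀ t ∈ spectrum ℝ A.op, |f t| ≤ K) (x : H) :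
    ⟪x, (borelFun A f hf hb).op x⟫_ℂ =
      ((∫ t, f t ∂BorelFC.spectralMeasure A.isSelfAdjoint_op x : ℝ) : ℂ) :=
  (existsUnique_borelFun A hf hb).choose_spec.1 x

/-! ### Valuation functions -/

/-- `v : R_sa → ℝ` is a valuation function: `v(A) ∈ sp A`, and `v(f(A)) = f(v(A))` for all Borel
functions `f : ℝ → ℝ` for which `f(A)` is a bounded operator (`f` bounded on `sp A`). -/
structure IsValuationFunction (R : VonNeumannAlgebra H) (v : R.SelfAdjointPart → ℝ) : Prop where
  spectrum_rule : ∀ A : R.SelfAdjointPart, v A ∈ spectrum ℝ A.op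
  func : ∀ (A : R.SelfAdjointPart) (f : ℝ → ℝ) (hf : Measurable f)
    (hb : ∃ K, ∀ t ∈ spectrum ℝ A.op, |f t| ≤ K), v (borelFun A f hf hb) = f (v A)

/-- The extension `v' : R → ℂ`, `v'(A₁ + i A₂) = v(A₁) + i v(A₂)` with `A₁, A₂` self-adjoint. -/
def extend {R : VonNeumannAlgebra H} (v : R.SelfAdjointPart → ℝ) (B : R.toStarSubalgebra) : ℂ :=
  (v (realPart B) : ℂ) + Complex.I * (v (imaginaryPart B) : ℂ)

/-- The inclusion `M ⊆ R` of von Neumann algebras on `H`. -/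
def incl {M R : VonNeumannAlgebra H} (h : M ≤ R) : M.toStarSubalgebra →⋆ₐ[ℂ] R.toStarSubalgebra :=
  StarSubalgebra.inclusion (S₁ := M.toStarSubalgebra) (S₂ := R.toStarSubalgebra) h

/-- The inclusion `M_sa ⊆ R_sa`. -/
def inclSA {M R : VonNeumannAlgebra H} (h : M ≤ R) (A : M.SelfAdjointPart) : R.SelfAdjointPart :=
  ⟨incl h A, A.2.map (incl h)⟩

end VonNeumannAlgebra

end

/-!
A valuation function `v` only takes eigenvalues, and it does so jointly on commuting elements. This
makes a generator of the abelian subalgebra, and with it the separability of `H`, unnecessary.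

Fix `A ∈ R_sa` and put `a = v(A)`. The spectral projection `P = χ_{a}(A)` has
`v(P) = χ_{a}(v(A)) = 1`, so `P ≠ 0`, and `A P = a P`: the value `a` is an eigenvalue
(`exists_spectralProjection`). The Borel calculus being given only through the measures
`⟪x, E_A x⟫`, the identities `A P = a P` and `P ^ 2 = P` are derived from the fact that `g(A) x` has
the spectral measure of `x` multiplied by `g ^ 2`, for continuous `g`
(`spectralMeasure_cfcHom_apply`).

If `P` and `Q` are commuting projections with `v(P) = v(Q) = 1`, then `P`, `Q` and `P Q` are
polynomials in `P + 2 Q`, and the functional rule for polynomials gives `v(P Q) = 1`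
(`apply_mul_eq_one`). Multiplying the spectral projections of a finite commuting family therefore
gives a projection of value `1`, hence nonzero, whose range consists of joint eigenvectors with
eigenvalues the values of `v` (`exists_joint_eigenvector`).

For `B`, `C` in an abelian subalgebra there is thus one vector `x ≠ 0` at which `B`, `C`, `B + C`
and `B C` all act as multiplication by their values under the extension of `v`. Comparing these
actions on `x` gives additivity, homogeneity, multiplicativity and the bound `|v'(B)| ≤ ‖B‖`.
-/

namespace BorelFC

open MeasureTheory
open scoped InnerProductSpace

variable {H : Type*} [NormedAddCommGroup H] [InnerProductSpace ℂ H] [CompleteSpace H]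

/-! ### Spectral measures and spectral projections at a point -/

theorem isSpectralIntegral_cfcHom {A : H →L[ℂ] H} (hA : IsSelfAdjoint A)
    (g : C(spectrum ℝ A, ℝ)) : IsSpectralIntegral hA g (cfcHom (R := ℝ) hA g) := by
  intro x
  have h1 := RealRMK.integral_rieszMeasure (spectralFunctional hA x)
    (CompactlySupportedContinuousMap.continuousMapEquiv g)
  have h2 : IsSelfAdjoint (cfcHom (R := ℝ) hA g) := cfcHom_predicate hA g
  apply Complex.ext
  · rw [Complex.ofReal_re]
    exact h1.symm
  · rw [Complex.ofReal_im]
    exact (ContinuousLinearMap.isSelfAdjoint_iff_isSymmetric.1 h2).im_inner_self_apply x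

theorem isSpectralIntegral_aeval {A : H →L[ℂ] H} (hA : IsSelfAdjoint A) (p : Polynomial ℝ) :
    IsSpectralIntegral hA (fun t => p.eval (t : ℝ)) (Polynomial.aeval A p) := by
  have h := isSpectralIntegral_cfcHom hA
    (Polynomial.aeval ((ContinuousMap.id ℝ).restrict (spectrum ℝ A)) p)
  rw [← Polynomial.aeval_algHom_apply, cfcHom_id] at h
  convert h using 2 with t
  rw [Polynomial.aeval_continuousMap_apply, ← Polynomial.coe_aeval_eq_eval]
  rfl

/-- Passing from `x` to `g(A) x` multiplies the spectral measure by `g ^ 2`: this is how the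
multiplicativity of the continuous functional calculus enters for Borel functions. -/
theorem spectralMeasure_cfcHom_apply {A : H →L[ℂ] H} (hA : IsSelfAdjoint A)
    (g : C(spectrum ℝ A, ℝ)) (x : H) :
    spectralMeasure hA (cfcHom (R := ℝ) hA g x) =
      (spectralMeasure hA x).withDensity (fun t => ((g t ^ 2).toNNReal : ENNReal)) := by
  have hfin : IsFiniteMeasure
      ((spectralMeasure hA x).withDensity (fun t => ((g t ^ 2).toNNReal : ENNReal))) := by
    refine isFiniteMeasure_withDensity_ofReal (f := fun t => g t ^ 2) ?_
    refine (BoundedContinuousFunction.integrable (spectralMeasure hA x)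
      (BoundedContinuousFunction.mkOfCompact (g ^ 2))).hasFiniteIntegral
  refine ext_of_forall_integral_eq_of_IsFiniteMeasure fun f => ?_
  rw [integral_withDensity_eq_integral_smul (by fun_prop)]
  have h1 := isSpectralIntegral_cfcHom hA f.toContinuousMap (cfcHom (R := ℝ) hA g x)
  have h2 := isSpectralIntegral_cfcHom hA (g * f.toContinuousMap * g) x
  have hsa : (cfcHom (R := ℝ) hA g).adjoint = cfcHom (R := ℝ) hA g :=
    (ContinuousLinearMap.isSelfAdjoint_iff'.1 (cfcHom_predicate hA g))
  have h3 : ⟪x, cfcHom (R := ℝ) hA (g * f.toContinuousMap * g) x⟫_ℂ =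
      ⟪cfcHom (R := ℝ) hA g x,
        cfcHom (R := ℝ) hA f.toContinuousMap (cfcHom (R := ℝ) hA g x)⟫_ℂ := by
    rw [← ContinuousLinearMap.adjoint_inner_right, hsa, map_mul, map_mul]
    rfl
  rw [h1, h2, Complex.ofReal_inj] at h3
  refine h3.symm.trans (integral_congr_ae (ae_of_all _ fun t => ?_))
  simp only [NNReal.smul_def, Real.coe_toNNReal _ (sq_nonneg (g t)), smul_eq_mul,
    ContinuousMap.mul_apply]
  change g t * f t * g t = g t ^ 2 * f t
  ring

section Singleton

variable {A P : H →L[ℂ] H} {hA : IsSelfAdjoint A} {a : ℝ}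

/-- The spectral projection of `A` at `{a}` maps into the `a`-eigenspace of `A`. -/
theorem IsSpectralIntegral.mul_eq_smul
    (hP : IsSpectralIntegral hA (fun t => ({a} : Set ℝ).indicator (fun _ => (1 : ℝ)) t) P)
    (hAP : Commute A P) : A * P = (a : ℂ) • P := by
  set D : H →L[ℂ] H := Polynomial.aeval A (Polynomial.X - Polynomial.C a) with hD
  have hD' : D = A - (a : ℂ) • 1 := by
    simp only [hD, map_sub, Polynomial.aeval_X, Polynomial.aeval_C,
      Algebra.algebraMap_eq_smul_one, Complex.coe_smul]
  have hDg : D = cfcHom (R := ℝ) hA ((ContinuousMap.id ℝ).restrict (spectrum ℝ A) -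
      algebraMap ℝ C(spectrum ℝ A, ℝ) a) := by
    rw [map_sub, cfcHom_id, AlgHomClass.commutes, hD]
    simp
  have hDsa : IsSelfAdjoint D := (isSpectralIntegral_aeval hA _).isSelfAdjoint
  have hPsa := hP.isSelfAdjoint
  have hDP : Commute D P := by
    rw [hD']
    exact hAP.sub_left ((Commute.one_left P).smul_left _)
  have h0 : D * P * D = 0 := by
    apply ContinuousLinearMap.coe_injective
    rw [← ext_inner_map]
    intro x
    have h1 := hP (D x)
    -- the density `(t - a) ^ 2` of the spectral measure at `D x` vanishes at `a`
    have h2 : (∫ t, ({a} : Set ℝ).indicator (fun _ => (1 : ℝ)) (t : ℝ)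
        ∂spectralMeasure hA (D x)) = 0 := by
      rw [hDg, spectralMeasure_cfcHom_apply, integral_withDensity_eq_integral_smul (by fun_prop)]
      refine integral_eq_zero_of_ae (ae_of_all _ fun t => ?_)
      by_cases ht : (t : ℝ) = a <;> simp [ht]
    rw [h2, Complex.ofReal_zero, ← ContinuousLinearMap.adjoint_inner_right,
      ContinuousLinearMap.isSelfAdjoint_iff'.1 hDsa] at h1
    change ⟪D (P (D x)), x⟫_ℂ = ⟪(0 : H), x⟫_ℂ
    rw [← inner_conj_symm, h1]
    simp
  have h1 : D * P = 0 := by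
    rw [← CStarRing.star_mul_self_eq_zero_iff, star_mul, hDsa.star_eq, hPsa.star_eq]
    calc P * D * (D * P) = P * (D * P * D) := by rw [mul_assoc, mul_assoc D P D, ← hDP.eq]
      _ = 0 := by rw [h0, mul_zero]
  rw [hD', sub_mul, sub_eq_zero, smul_mul_assoc, one_mul] at h1
  exact h1

theorem IsSpectralIntegral.isIdempotentElem
    (hP : IsSpectralIntegral hA (fun t => ({a} : Set ℝ).indicator (fun _ => (1 : ℝ)) t) P)
    (hAP : Commute A P) : P * P = P := by
  have hPsa := hP.isSelfAdjoint
  have hev := hP.mul_eq_smul hAP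
  -- the spectral measure at a vector of the range of `P` is carried by `{a}`
  have h3 : P * P * P = P * P := by
    apply ContinuousLinearMap.coe_injective
    rw [← ext_inner_map]
    intro x
    have hx : A (P x) = (a : ℂ) • P x := DFunLike.congr_fun hev x
    have h1 := isSpectralIntegral_aeval hA ((Polynomial.X - Polynomial.C a) ^ 2) (P x)
    have h2 : Polynomial.aeval A ((Polynomial.X - Polynomial.C a) ^ 2) (P x) = 0 := by
      have : Polynomial.aeval A (Polynomial.X - Polynomial.C a) (P x) = 0 := by
        simp [Algebra.algebraMap_eq_smul_one, hx]
      rw [map_pow, pow_two, mul_apply_eq_comp, this, map_zero]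
    rw [h2, inner_zero_right, eq_comm, Complex.ofReal_eq_zero,
      integral_eq_zero_iff_of_nonneg] at h1
    · have h4 : ⟪P x, P (P x)⟫_ℂ = ((∫ t : spectrum ℝ A,
          ({a} : Set ℝ).indicator (fun _ => (1 : ℝ)) (t : ℝ) ∂spectralMeasure hA (P x) : ℝ) : ℂ) :=
        hP (P x)
      have h5 := isSpectralIntegral_aeval hA 1 (P x)
      have h6 : ∫ t : spectrum ℝ A, ({a} : Set ℝ).indicator (fun _ => (1 : ℝ)) (t : ℝ)
          ∂spectralMeasure hA (P x) =
          ∫ t : spectrum ℝ A, (1 : Polynomial ℝ).eval (t : ℝ) ∂spectralMeasure hA (P x) := by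
        refine integral_congr_ae ?_
        filter_upwards [h1] with t ht
        have : (t : ℝ) = a := by simpa [sub_eq_zero] using ht
        simp [this]
      rw [h6, ← h5, map_one, one_apply_eq_self, ← ContinuousLinearMap.adjoint_inner_right,
        ← ContinuousLinearMap.adjoint_inner_right P,
        ContinuousLinearMap.isSelfAdjoint_iff'.1 hPsa] at h4
      change ⟪P (P (P x)), x⟫_ℂ = ⟪P (P x), x⟫_ℂ
      rw [← inner_conj_symm, h4, inner_conj_symm]
    · exact fun t => by simp only [Polynomial.eval_pow]; exact sq_nonneg _
    · exact BoundedContinuousFunction.integrable (spectralMeasure hA (P x))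
        (BoundedContinuousFunction.mkOfCompact
          ⟨fun t : spectrum ℝ A => ((Polynomial.X - Polynomial.C a) ^ 2).eval (t : ℝ),
            by fun_prop⟩)
  have hsa : star (P * P - P) = P * P - P := by
    rw [star_sub, star_mul, hPsa.star_eq]
  rw [← sub_eq_zero, ← CStarRing.star_mul_self_eq_zero_iff, hsa]
  have h4 : P * P * (P * P) = P * P := by rw [← mul_assoc, h3, h3]
  rw [mul_sub, sub_mul, sub_mul, h4, h3, ← mul_assoc, h3]
  abel

end Singleton

end BorelFC

namespace VonNeumannAlgebra

open scoped InnerProductSpace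

variable {H : Type*} [NormedAddCommGroup H] [InnerProductSpace ℂ H] [CompleteSpace H]
  {R M : VonNeumannAlgebra H}

/-! ### Valuation functions on commuting self-adjoint elements -/

/-- A self-adjoint operator that belongs to `R`, as an element of `R_sa`. -/
def SelfAdjointPart.ofOp (T : H →L[ℂ] H) (hT : T ∈ R) (hs : IsSelfAdjoint T) :
    R.SelfAdjointPart :=
  ⟨⟨T, hT⟩, Subtype.ext hs⟩

theorem SelfAdjointPart.op_mem (A : R.SelfAdjointPart) : A.op ∈ R :=
  (A : R.toStarSubalgebra).2

theorem SelfAdjointPart.op_injective :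
    Function.Injective (SelfAdjointPart.op : R.SelfAdjointPart → H →L[ℂ] H) :=
  fun _ _ h => Subtype.ext (Subtype.ext h)

theorem isSpectralIntegral_borelFun (A : R.SelfAdjointPart) (f : ℝ → ℝ) (hf : Measurable f)
    (hb : ∃ K, ∀ t ∈ spectrum ℝ A.op, |f t| ≤ K) :
    BorelFC.IsSpectralIntegral A.isSelfAdjoint_op (fun t => f t) (borelFun A f hf hb).op :=
  inner_borelFun A f hf hb

theorem commute_borelFun (A : R.SelfAdjointPart) (f : ℝ → ℝ) (hf : Measurable f)
    (hb : ∃ K, ∀ t ∈ spectrum ℝ A.op, |f t| ≤ K) {T : H →L[ℂ] H} (hT : Commute A.op T) :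
    Commute (borelFun A f hf hb).op T := by
  obtain ⟨B, hB, hB'⟩ := BorelFC.hasIntegral_of_bounded A.isSelfAdjoint_op
    (f := fun t => f t) (hf.comp measurable_subtype_coe)
    (fun t => hb.choose_spec t t.2)
  rw [(isSpectralIntegral_borelFun A f hf hb).unique hB]
  exact hB' T hT

namespace IsValuationFunction

variable {v : R.SelfAdjointPart → ℝ} (hv : R.IsValuationFunction v)
include hv

theorem apply_eq_eval {A B : R.SelfAdjointPart} {p : Polynomial ℝ}
    (h : B.op = Polynomial.aeval A.op p) : v B = p.eval (v A) := by
  have hb : ∃ K, ∀ t ∈ spectrum ℝ A.op, |p.eval t| ≤ K :=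
    (spectrum.isCompact A.op).exists_bound_of_continuousOn p.continuous.continuousOn
  have h1 : borelFun A (fun t => p.eval t) p.continuous.measurable hb = B := by
    refine SelfAdjointPart.op_injective ((isSpectralIntegral_borelFun A _ _ hb).unique ?_)
    rw [h]
    exact BorelFC.isSpectralIntegral_aeval _ p
  rw [← h1, hv.func]

theorem op_ne_zero {A : R.SelfAdjointPart} (hA : v A ≠ 0) : A.op ≠ 0 := by
  intro h
  refine hA ?_
  rw [hv.apply_eq_eval (A := A) (B := A) (p := 0) (by rw [h, map_zero]), Polynomial.eval_zero]

/-- The projections of value `1` in a commuting family are closed under products: `P`, `Q` and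
`P Q` are polynomials in the single element `P + 2 Q`, whose spectrum lies in `{0, 1, 2, 3}`. -/
theorem apply_mul_eq_one {P Q E : R.SelfAdjointPart} (hP : P.op * P.op = P.op)
    (hQ : Q.op * Q.op = Q.op) (hPQ : Commute P.op Q.op) (hE : E.op = P.op * Q.op)
    (hvP : v P = 1) (hvQ : v Q = 1) : v E = 1 := by
  set p := P.op with hp
  set q := Q.op with hq
  let C : R.SelfAdjointPart := SelfAdjointPart.ofOp (p + (q + q))
    (add_mem P.op_mem (add_mem Q.op_mem Q.op_mem))
    (P.isSelfAdjoint_op.add (Q.isSelfAdjoint_op.add Q.isSelfAdjoint_op))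
  have hC : C.op = p + (q + q) := rfl
  have hqp : q * p = p * q := hPQ.eq.symm
  have hpq1 : p * (p * q) = p * q := by rw [← mul_assoc, hP]
  have hpq2 : p * q * p = p * q := by rw [mul_assoc, hqp, hpq1]
  have hpq3 : p * q * q = p * q := by rw [mul_assoc, hQ]
  have hC2 : C.op ^ 2 = p + (4 : ℝ) • (p * q) + (4 : ℝ) • q := by
    rw [hC, pow_two]
    simp only [mul_add, add_mul, hP, hQ, hqp]
    module
  have hC3 : C.op ^ 3 = p + (18 : ℝ) • (p * q) + (8 : ℝ) • q := by
    rw [pow_succ, hC2, hC]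
    simp only [mul_add, add_mul, smul_mul_assoc, hP, hQ, hqp, hpq2, hpq3]
    module
  have key : ∀ (a b c : ℝ), Polynomial.aeval C.op (Polynomial.C a * Polynomial.X ^ 3 +
      Polynomial.C b * Polynomial.X ^ 2 + Polynomial.C c * Polynomial.X) =
      (a + b + c) • p + (18 * a + 4 * b) • (p * q) + (8 * a + 4 * b + 2 * c) • q := by
    intro a b c
    simp only [map_add, map_mul, Polynomial.aeval_C, map_pow, Polynomial.aeval_X, hC3, hC2,
      Algebra.algebraMap_eq_smul_one, smul_mul_assoc, one_mul]
    rw [hC]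
    module
  -- the cubics take the values `0, 1, 0, 1`, then `0, 0, 1, 1`, then `0, 0, 0, 1` at `0, 1, 2, 3`
  have h1 := hv.apply_eq_eval (A := C) (B := P) ((key (2 / 3) (-3) (10 / 3)).trans
    (by rw [← hp]; module)).symm
  have h2 := hv.apply_eq_eval (A := C) (B := Q) ((key (-1 / 3) (3 / 2) (-7 / 6)).trans
    (by rw [← hq]; module)).symm
  have h3 := hv.apply_eq_eval (A := C) (B := E) ((key (1 / 6) (-1 / 2) (1 / 3)).trans
    (by rw [hE]; module)).symm
  simp only [Polynomial.eval_add, Polynomial.eval_mul, Polynomial.eval_C, Polynomial.eval_pow,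
    Polynomial.eval_X] at h1 h2 h3
  have hc : v C = 3 := by linarith
  rw [h3, hc]
  norm_num

/-- The spectral projection of `A` at `v A` has value `1`. -/
theorem exists_spectralProjection (A : R.SelfAdjointPart) :
    ∃ P : R.SelfAdjointPart, v P = 1 ∧ P.op * P.op = P.op ∧ A.op * P.op = (v A : ℂ) • P.op ∧
      ∀ T : H →L[ℂ] H, Commute A.op T → Commute P.op T := by
  have hf : Measurable (({v A} : Set ℝ).indicator fun _ => (1 : ℝ)) :=
    measurable_const.indicator (measurableSet_singleton _)
  have hb : ∃ K, ∀ t ∈ spectrum ℝ A.op, |({v A} : Set ℝ).indicator (fun _ => (1 : ℝ)) t| ≤ K := by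
    refine ⟨1, fun t _ => ?_⟩
    by_cases ht : t = v A <;> simp [ht]
  have hP := isSpectralIntegral_borelFun A _ hf hb
  have hc := (commute_borelFun A _ hf hb (Commute.refl A.op)).symm
  exact ⟨_, by simp [hv.func], hP.isIdempotentElem hc, hP.mul_eq_smul hc,
    fun T hT => commute_borelFun A _ hf hb hT⟩

/-- A finite commuting family has a joint spectral projection, of value `1`, at its values. -/
theorem exists_joint_spectralProjection (l : List R.SelfAdjointPart)
    (hl : ∀ A ∈ l, ∀ B ∈ l, Commute A.op B.op) :
    ∃ E : R.SelfAdjointPart, v E = 1 ∧ E.op * E.op = E.op ∧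
      (∀ A ∈ l, A.op * E.op = (v A : ℂ) • E.op) ∧
      ∀ T : H →L[ℂ] H, (∀ A ∈ l, Commute A.op T) → Commute E.op T := by
  induction l with
  | nil =>
    let E : R.SelfAdjointPart := 1
    have hE : E.op = 1 := rfl
    refine ⟨E, ?_, by rw [hE, one_mul], by simp, fun T _ => by rw [hE]; exact Commute.one_left T⟩
    rw [hv.apply_eq_eval (A := E) (B := E) (p := 1) (by rw [map_one, hE]), Polynomial.eval_one]
  | cons A l ih =>
    obtain ⟨E, hvE, hE, hlE, hEc⟩ := ih fun B hB C hC =>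
      hl B (List.mem_cons_of_mem _ hB) C (List.mem_cons_of_mem _ hC)
    obtain ⟨P, hvP, hP, hAP, hPc⟩ := hv.exists_spectralProjection A
    have hPE : Commute P.op E.op := hPc _ (hEc _ fun B hB =>
      hl B (List.mem_cons_of_mem _ hB) A List.mem_cons_self).symm
    let F : R.SelfAdjointPart := SelfAdjointPart.ofOp (P.op * E.op) (mul_mem P.op_mem E.op_mem)
      (P.isSelfAdjoint_op.commute_iff E.isSelfAdjoint_op |>.1 hPE)
    have hF : F.op = P.op * E.op := rfl
    refine ⟨F, hv.apply_mul_eq_one hP hE hPE hF hvP hvE, ?_, ?_, fun T hT => ?_⟩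
    · rw [hF, hPE.symm.mul_mul_mul_comm, hP, hE]
    · intro B hB
      rcases List.mem_cons.1 hB with rfl | hB
      · rw [hF, ← mul_assoc, hAP, smul_mul_assoc]
      · rw [hF, hPE.eq, ← mul_assoc, hlE B hB, smul_mul_assoc]
    · rw [hF]
      exact (hPc T (hT A List.mem_cons_self)).mul_left
        (hEc T fun B hB => hT B (List.mem_cons_of_mem _ hB))

theorem exists_joint_eigenvector (l : List R.SelfAdjointPart)
    (hl : ∀ A ∈ l, ∀ B ∈ l, Commute A.op B.op) :
    ∃ x : H, x ≠ 0 ∧ ∀ A ∈ l, A.op x = (v A : ℂ) • x := by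
  obtain ⟨E, hvE, -, hE, -⟩ := hv.exists_joint_spectralProjection l hl
  obtain ⟨y, hy⟩ : ∃ y, E.op y ≠ 0 := by
    by_contra! h
    exact hv.op_ne_zero (by rw [hvE]; exact one_ne_zero) (ContinuousLinearMap.ext h)
  exact ⟨E.op y, hy, fun A hA => DFunLike.congr_fun (hE A hA) y⟩

end IsValuationFunction

end VonNeumannAlgebra

namespace VonNeumannAlgebra

variable {H : Type*} [NormedAddCommGroup H] [InnerProductSpace ℂ H] [CompleteSpace H]
  {R M : VonNeumannAlgebra H}

/-! ### The character of an abelian subalgebra -/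

theorem realPart_incl (h : M ≤ R) (B : M.toStarSubalgebra) :
    realPart (incl h B) = inclSA h (realPart B) := by
  refine Subtype.ext (Subtype.ext ?_)
  rfl

theorem imaginaryPart_incl (h : M ≤ R) (B : M.toStarSubalgebra) :
    imaginaryPart (incl h B) = inclSA h (imaginaryPart B) := by
  refine Subtype.ext (Subtype.ext ?_)
  rfl

namespace IsValuationFunction

variable {v : R.SelfAdjointPart → ℝ} (hv : R.IsValuationFunction v)
include hv

/-- Finitely many elements of an abelian subalgebra have a common eigenvector, the eigenvalues
being the values of the extension of `v`. -/
theorem exists_joint_eigenvector_extend (h : M ≤ R) (hM : ∀ a ∈ M, ∀ b ∈ M, a * b = b * a)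
    (l : List M.toStarSubalgebra) :
    ∃ x : H, x ≠ 0 ∧ ∀ B ∈ l, (B : H →L[ℂ] H) x = extend v (incl h B) • x := by
  obtain ⟨x, hx, hl⟩ := hv.exists_joint_eigenvector
    ((l.flatMap fun B => [realPart B, imaginaryPart B]).map (inclSA h)) (by
      intro A hA B hB
      obtain ⟨A, -, rfl⟩ := List.mem_map.1 hA
      obtain ⟨B, -, rfl⟩ := List.mem_map.1 hB
      exact hM _ A.op_mem _ B.op_mem)
  refine ⟨x, hx, fun B hB => ?_⟩
  have h1 := hl (inclSA h (realPart B))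
    (List.mem_map_of_mem (List.mem_flatMap.2 ⟨B, hB, by simp⟩))
  have h2 := hl (inclSA h (imaginaryPart B))
    (List.mem_map_of_mem (List.mem_flatMap.2 ⟨B, hB, by simp⟩))
  have h3 : (B : H →L[ℂ] H) =
      (inclSA h (realPart B)).op + Complex.I • (inclSA h (imaginaryPart B)).op :=
    congrArg Subtype.val (realPart_add_I_smul_imaginaryPart B).symm
  rw [h3, extend, realPart_incl, imaginaryPart_incl, add_apply, smul_apply, h1, h2, add_smul,
    mul_smul]

/-- The extension of a valuation function is a linear functional on an abelian subalgebra: both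
sides of each identity are eigenvalues at a common eigenvector. -/
noncomputable def extendLinearMap (h : M ≤ R) (hM : ∀ a ∈ M, ∀ b ∈ M, a * b = b * a) :
    M.toStarSubalgebra →ₗ[ℂ] ℂ where
  toFun B := extend v (incl h B)
  map_add' B C := by
    obtain ⟨x, hx, hl⟩ := hv.exists_joint_eigenvector_extend h hM [B, C, B + C]
    refine smul_left_injective ℂ hx ?_
    simp only [add_smul]
    rw [← hl B (by simp), ← hl C (by simp), ← hl (B + C) (by simp)]
    rfl
  map_smul' c B := by
    obtain ⟨x, hx, hl⟩ := hv.exists_joint_eigenvector_extend h hM [B, c • B]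
    refine smul_left_injective ℂ hx ?_
    simp only [smul_eq_mul, mul_smul, RingHom.id_apply]
    rw [← hl B (by simp), ← hl (c • B) (by simp)]
    rfl

theorem extend_mul (h : M ≤ R) (hM : ∀ a ∈ M, ∀ b ∈ M, a * b = b * a)
    (B C : M.toStarSubalgebra) :
    extend v (incl h (B * C)) = extend v (incl h B) * extend v (incl h C) := by
  obtain ⟨x, hx, hl⟩ := hv.exists_joint_eigenvector_extend h hM [B, C, B * C]
  refine smul_left_injective ℂ hx ?_
  have h1 : (B * C : M.toStarSubalgebra).1 x = B.1 (C.1 x) := rfl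
  change extend v (incl h (B * C)) • x = (extend v (incl h B) * extend v (incl h C)) • x
  rw [← hl (B * C) (by simp), h1, hl C (by simp), map_smul, hl B (by simp), smul_smul, mul_comm]

theorem extend_one (h : M ≤ R) (hM : ∀ a ∈ M, ∀ b ∈ M, a * b = b * a) :
    extend v (incl h (1 : M.toStarSubalgebra)) = 1 := by
  obtain ⟨x, hx, hl⟩ := hv.exists_joint_eigenvector_extend h hM [1]
  refine smul_left_injective ℂ hx ?_
  change extend v (incl h 1) • x = (1 : ℂ) • x
  rw [← hl 1 (by simp), one_smul]
  rfl

theorem norm_extend_le (h : M ≤ R) (hM : ∀ a ∈ M, ∀ b ∈ M, a * b = b * a)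
    (B : M.toStarSubalgebra) : ‖extend v (incl h B)‖ ≤ ‖B‖ := by
  obtain ⟨x, hx, hl⟩ := hv.exists_joint_eigenvector_extend h hM [B]
  refine le_of_mul_le_mul_right ?_ (norm_pos_iff.2 hx)
  rw [← norm_smul, ← hl B (by simp)]
  exact (B : H →L[ℂ] H).le_opNorm x

theorem extend_inclSA (h : M ≤ R) (A : M.SelfAdjointPart) :
    extend v (incl h (A : M.toStarSubalgebra)) = v (inclSA h A) := by
  have h0 : v (0 : R.SelfAdjointPart) = 0 := by
    by_contra hne
    exact hv.op_ne_zero hne rfl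
  have h1 : realPart (A : M.toStarSubalgebra) = A := Subtype.ext A.2.coe_realPart
  have h2 : inclSA h (0 : M.SelfAdjointPart) = 0 := Subtype.ext (map_zero (incl h))
  rw [extend, realPart_incl, imaginaryPart_incl, h1, A.2.imaginaryPart, h2, h0]
  simp

end IsValuationFunction

end VonNeumannAlgebra

theorem mainTheorem5 {H : Type*} [NormedAddCommGroup H] [InnerProductSpace ℂ H] [CompleteSpace H]
    [TopologicalSpace.SeparableSpace H] (R : VonNeumannAlgebra H)
    (v : R.SelfAdjointPart → ℝ) (hv : R.IsValuationFunction v)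
    (M : VonNeumannAlgebra H) (hMR : M ≤ R) (hM : ∀ a ∈ M, ∀ b ∈ M, a * b = b * a) :
    (∃ χ : WeakDual.characterSpace ℂ M.toStarSubalgebra,
      ∀ B : M.toStarSubalgebra,
        χ B = VonNeumannAlgebra.extend v (VonNeumannAlgebra.incl hMR B)) ∧
    (∃ φ : M.SelfAdjointPart →ₗ[ℝ] ℝ,
      ∀ A : M.SelfAdjointPart, φ A = v (VonNeumannAlgebra.inclSA hMR A)) := by
  have hφ := hv.extend_inclSA hMR
  refine ⟨⟨⟨StrongDual.toWeakDual ((hv.extendLinearMap hMR hM).mkContinuous 1 fun B => ?_), ?_, ?_⟩,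
    fun B => rfl⟩, ⟨⟨fun A => v (VonNeumannAlgebra.inclSA hMR A), fun A B => ?_⟩, fun c A => ?_⟩,
    fun A => rfl⟩
  · rw [one_mul]
    exact hv.norm_extend_le hMR hM B
  · intro h0
    have h1 := DFunLike.congr_fun h0 1
    exact one_ne_zero ((hv.extend_one hMR hM).symm.trans h1)
  · exact hv.extend_mul hMR hM
  · have h1 := (hv.extendLinearMap hMR hM).map_add (A : M.toStarSubalgebra) B
    rw [← Complex.ofReal_inj, Complex.ofReal_add, ← hφ, ← hφ, ← hφ]
    exact h1
  · have h1 := (hv.extendLinearMap hMR hM).map_smul (c : ℂ) (A : M.toStarSubalgebra)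
    rw [← Complex.ofReal_inj]
    simp only [RingHom.id_apply, smul_eq_mul, Complex.ofReal_mul]
    rw [← hφ, ← hφ]
    exact h1
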